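/- Let $S=(S_1,\dots,S_m)$ have independent coordinates $S_j\sim\mathcal N(0,\sigma_j^2)$ and let the raw observation be $X=S$. Let $\mathcal Q$ be a measurable space of queries and $Q\sim\mu$ a random query in $\mathcal Q$ independent of $S$. For every $q\in\mathcal Q$ the correct answer is $Y_q=S$, predictions lie in $\mathbb R^m$, and the loss is $\ell_q(a,s)=\sum_{j=1}^m\alpha_{qj}(a_j-s_j)^2$, where $\alpha_{qj}\ge 0$ depends measurably on $q$. Let $\varepsilon\ge 0$. For an observation $W$ put $\mathcal R_W^\star(q)=\inf_\phi\mathbb E[\ell_q(\phi(W),S)]$, the infimum over measurable $\phi$. A query-agnostic compressor is a conditional law $P_{Z|X}$, and a query-conditioned compressor a conditional law $P_{Z|X,Q}$, with $Z$ in an arbitrary standard Borel space; $\mathcal R^\star_{Z|q}(q)$ denotes the Bayes risk of $Z$ for query $q$ when $Z\sim P_{Z|X,Q=q}$. Define, with mutual information in nats, $$R^\star(\varepsilon)=\inf_{P_{Z|X}}\Big\{I(X;Z):\ \sup_{q\in\mathcal Q}\big(\mathcal R_Z^\star(q)-\mathcal R_X^\star(q)\big)\le\varepsilon\Big\},$$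 $$R^\star_{\rm cond}(\varepsilon)=\inf_{P_{Z|X,Q}}\Big\{I(X;Z\mid Q):\ \sup_{q\in\mathcal Q}\big(\mathcal R_{Z|q}^\star(q)-\mathcal R_X^\star(q)\big)\le\varepsilon\Big\}.$$ Write $\log^+t=\max\{0,\log t\}$, with $\log^+(\sigma^2/0)=\infty$ for $\sigma>0$ and $\log^+(0/0)=0$; all rates lie in $[0,\infty]$. Then: 1. $\mathcal R_X^\star(q)=0$ for every $q\in\mathcal Q$. 2. The query-agnostic frontier is $$R^\star(\varepsilon)=\min\Big\{\tfrac12\sum_{j=1}^m\log^+\frac{\sigma_j^2}{d_j}:\ 0\le d_j\le\sigma_j^2,\ \sum_{j=1}^m\alpha_{qj}d_j\le\varepsilon\ \text{ for all } q\in\mathcal Q\Big\},$$ and the minimum is attained. 3. The query-conditioned frontier is $R^\star_{\rm cond}(\varepsilon)=\mathbb E_Q[r(Q)]$, where $$r(q)=\min\Big\{\tfrac12\sum_{j=1}^m\log^+\frac{\sigma_j^2}{d_j}:\ 0\le d_j\le\sigma_j^2,\ \sum_{j=1}^m\alpha_{qj}d_j\le\varepsilon\Big\};$$ each of these minima is attained,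 and $r$ is measurable. 4. For each fixed $q$, the minimum $r(q)$ is attained by weighted reverse water-filling, $$d_j^\star(q)=\begin{cases}\sigma_j^2,&\alpha_{qj}=0,\\ \min\{\sigma_j^2,\nu_q/\alpha_{qj}\},&\alpha_{qj}>0,\end{cases}$$ for every $\nu_q\ge 0$ such that $\sum_j\alpha_{qj}d_j^\star(q)=\varepsilon$ if $\varepsilon\le\sum_j\alpha_{qj}\sigma_j^2$ (the constraint is active), and such that $d_j^\star(q)=\sigma_j^2$ for all $j$ otherwise. Such a $\nu_q$ exists, and $d^\star(q)$ is the unique minimizer whenever $r(q)<\infty$ (in particular whenever $\varepsilon>0$). -/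

import Mathlib

open MeasureTheory ProbabilityTheory
open scoped ENNReal NNReal

noncomputable section

namespace TaskCompression

section Framework

variable {Ω 𝒳 𝒴 𝒜 𝒲 𝒵 𝒬 : Type*}
  [MeasurableSpace Ω] [MeasurableSpace 𝒳] [MeasurableSpace 𝒜]
  [MeasurableSpace 𝒲] [MeasurableSpace 𝒵] [MeasurableSpace 𝒬]

/-- Bayes risk of predicting `Y` from the observation `W` under the loss `ℓ ≥ 0`:
`inf_φ E[ℓ(φ(W), Y)]` over measurable decision rules `φ`. The expectation is an extended
nonnegative integral, so a rule of infinite risk has risk `∞`. -/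
def bayesRisk (P : Measure Ω) (W : Ω → 𝒲) (Y : Ω → 𝒴) (ℓ : 𝒜 → 𝒴 → ℝ) : ℝ≥0∞ :=
  ⨅ (φ : 𝒲 → 𝒜) (_ : Measurable φ), ∫⁻ ω, ENNReal.ofReal (ℓ (φ (W ω)) (Y ω)) ∂P

/-- Mutual information `I(X;Z)` in nats: the Kullback–Leibler divergence of the joint law from
the product of the marginal laws. -/
def mutualInfo (P : Measure Ω) (X : Ω → 𝒳) (Z : Ω → 𝒵) : ℝ≥0∞ :=
  InformationTheory.klDiv (P.map fun ω => (X ω, Z ω)) ((P.map X).prod (P.map Z))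

/-- The probability space `Ω × 𝒵` obtained by drawing, on top of `ω ∼ P`, a representation
`Z ∼ κ(X(ω), ·)`. The representation is the second coordinate; given `X` it is conditionally
independent of everything else. -/
def compressed (P : Measure Ω) (X : Ω → 𝒳) (hX : Measurable X) (κ : Kernel 𝒳 𝒵) :
    Measure (Ω × 𝒵) :=
  P ⊗ₘ (κ.comap X hX)

/-- Bayes risk `R_Z⋆` of the representation `Z ∼ κ(X, ·)`. -/
def compressedRisk (P : Measure Ω) (X : Ω → 𝒳) (hX : Measurable X) (κ : Kernel 𝒳 𝒵)
    (Y : Ω → 𝒴) (ℓ : 𝒜 → 𝒴 → ℝ) : ℝ≥0∞ :=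
  bayesRisk (compressed P X hX κ) (fun p => p.2) (fun p => Y p.1) ℓ

/-- Information rate `I(X;Z)` of the representation `Z ∼ κ(X, ·)`. -/
def compressedRate (P : Measure Ω) (X : Ω → 𝒳) (hX : Measurable X) (κ : Kernel 𝒳 𝒵) : ℝ≥0∞ :=
  mutualInfo (compressed P X hX κ) (fun p => X p.1) (fun p => p.2)

/-- Familywise excess Bayes risk of a query-agnostic compressor. Observing `X` is never worse than
observing `Z`, so the subtraction in `ℝ≥0∞` is not truncated. -/
def excessRisk (P : Measure Ω) (X : Ω → 𝒳) (hX : Measurable X) (κ : Kernel 𝒳 𝒵)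
    (Y : 𝒬 → Ω → 𝒴) (ℓ : 𝒬 → 𝒜 → 𝒴 → ℝ) : ℝ≥0∞ :=
  ⨆ q, (compressedRisk P X hX κ (Y q) (ℓ q) - bayesRisk P X (Y q) (ℓ q))

/-- Familywise excess Bayes risk of a query-conditioned compressor `P_{Z|X,Q}`. The query is
exogenous, so that given `Q = q` the representation is drawn from `κ((X, q), ·)` while the law of
`X` and the answers is unchanged. -/
def condExcessRisk (P : Measure Ω) (X : Ω → 𝒳) (hX : Measurable X) (κ : Kernel (𝒳 × 𝒬) 𝒵)
    (Y : 𝒬 → Ω → 𝒴) (ℓ : 𝒬 → 𝒜 → 𝒴 → ℝ) : ℝ≥0∞ :=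
  ⨆ q, (compressedRisk P X hX (κ.sectL q) (Y q) (ℓ q) - bayesRisk P X (Y q) (ℓ q))

/-- Conditional mutual information `I(X;Z|Q) = E_Q[I(X;Z|Q=q)]` for `Q ∼ μ` independent of `X` and
`Z ∼ κ((X, Q), ·)`. -/
def condRate (P : Measure Ω) (X : Ω → 𝒳) (hX : Measurable X) (μ : Measure 𝒬)
    (κ : Kernel (𝒳 × 𝒬) 𝒵) : ℝ≥0∞ :=
  ∫⁻ q, compressedRate P X hX (κ.sectL q) ∂μ

/-- Query-agnostic information frontier: the infimum of `I(X;Z)` over all randomized compressors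
`P_{Z|X}` into arbitrary standard Borel representation spaces whose familywise excess risk is at
most `ε`; it is `∞` if there is none of finite rate. -/
def bayesFrontier (P : Measure Ω) (X : Ω → 𝒳) (hX : Measurable X)
    (Y : 𝒬 → Ω → 𝒴) (ℓ : 𝒬 → 𝒜 → 𝒴 → ℝ) (ε : ℝ) : ℝ≥0∞ :=
  ⨅ (𝒵 : Type) (_ : MeasurableSpace 𝒵) (_ : StandardBorelSpace 𝒵)
    (κ : Kernel 𝒳 𝒵) (_ : IsMarkovKernel κ)
    (_ : excessRisk P X hX κ Y ℓ ≤ ENNReal.ofReal ε),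
    compressedRate P X hX κ

/-- Query-conditioned information frontier: the infimum of `I(X;Z|Q)` over all randomized
compressors `P_{Z|X,Q}` whose conditioned familywise excess risk is at most `ε`. -/
def bayesFrontierCond (P : Measure Ω) (X : Ω → 𝒳) (hX : Measurable X) (μ : Measure 𝒬)
    (Y : 𝒬 → Ω → 𝒴) (ℓ : 𝒬 → 𝒜 → 𝒴 → ℝ) (ε : ℝ) : ℝ≥0∞ :=
  ⨅ (𝒵 : Type) (_ : MeasurableSpace 𝒵) (_ : StandardBorelSpace 𝒵)
    (κ : Kernel (𝒳 × 𝒬) 𝒵) (_ : IsMarkovKernel κ)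
    (_ : condExcessRisk P X hX κ Y ℓ ≤ ENNReal.ofReal ε),
    condRate P X hX μ κ

end Framework

section Gaussian

variable {m : ℕ} {𝒬 : Type*}

/-- Weighted quadratic loss `∑ⱼ aⱼ (bⱼ - sⱼ)²` with weights `a`, prediction `b`, answer `s`. -/
def quadLoss (a : Fin m → ℝ) (b s : Fin m → ℝ) : ℝ :=
  ∑ j, a j * (b j - s j) ^ 2

/-- `log⁺ (v / d)` for `v, d ≥ 0`, with value `∞` at `d = 0 < v` and `0` at `d = v = 0`. -/
def logPlusRatio (v d : ℝ) : ℝ≥0∞ :=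
  if 0 < v ∧ d = 0 then ∞ else ENNReal.ofReal (max 0 (Real.log (v / d)))

/-- `½ ∑ⱼ log⁺ (σⱼ² / dⱼ)`. -/
def allocRate (σ : Fin m → ℝ≥0) (d : Fin m → ℝ) : ℝ≥0∞ :=
  (1 / 2) * ∑ j, logPlusRatio ((σ j : ℝ) ^ 2) (d j)

/-- Distortion allocations `0 ≤ dⱼ ≤ σⱼ²` with `∑ⱼ aⱼ dⱼ ≤ ε`, for a single weight vector `a`. -/
def queryAllocations (σ : Fin m → ℝ≥0) (a : Fin m → ℝ) (ε : ℝ) : Set (Fin m → ℝ) :=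
  {d | (∀ j, 0 ≤ d j ∧ d j ≤ (σ j : ℝ) ^ 2) ∧ ∑ j, a j * d j ≤ ε}

/-- Distortion allocations `0 ≤ dⱼ ≤ σⱼ²` with `∑ⱼ α_{qj} dⱼ ≤ ε` for every query `q`. -/
def familyAllocations (σ : Fin m → ℝ≥0) (α : 𝒬 → Fin m → ℝ) (ε : ℝ) : Set (Fin m → ℝ) :=
  {d | (∀ j, 0 ≤ d j ∧ d j ≤ (σ j : ℝ) ^ 2) ∧ ∀ q, ∑ j, α q j * d j ≤ ε}

/-- Weighted reverse water-filling at level `ν`. -/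
def waterFill (σ : Fin m → ℝ≥0) (a : Fin m → ℝ) (ν : ℝ) (j : Fin m) : ℝ :=
  if a j = 0 then (σ j : ℝ) ^ 2 else min ((σ j : ℝ) ^ 2) (ν / a j)

/-- `ν ≥ 0` is a water level for tolerance `ε`. The constraint is active when even the largest
allocation `dⱼ = σⱼ²` uses up the tolerance; then water-filling at level `ν` meets the constraint
with equality. Otherwise water-filling at level `ν` is that largest allocation. -/
def IsWaterLevel (σ : Fin m → ℝ≥0) (a : Fin m → ℝ) (ε ν : ℝ) : Prop :=
  0 ≤ ν ∧
  (ε ≤ ∑ j, a j * (σ j : ℝ) ^ 2 → ∑ j, a j * waterFill σ a ν j = ε) ∧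
  (∑ j, a j * (σ j : ℝ) ^ 2 < ε → ∀ j, waterFill σ a ν j = (σ j : ℝ) ^ 2)

/-- `d` minimizes `½ ∑ⱼ log⁺ (σⱼ² / dⱼ)` over the allocations for the weights `a`. -/
def IsOptimalAllocation (σ : Fin m → ℝ≥0) (a : Fin m → ℝ) (ε : ℝ) (d : Fin m → ℝ) : Prop :=
  d ∈ queryAllocations σ a ε ∧ IsMinOn (allocRate σ) (queryAllocations σ a ε) d

end Gaussian

end TaskCompression

end

/-! Since `X = S` allows exact reproduction, excess risk is risk, and quadratic risk is a weighted
sum of coordinate mean squared errors. Coordinates can be estimated separately and independently of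
the weights, so the vector `d` of minimal errors of a representation bounds its risk from below for
all queries at once (`exists_allocation_le_klDiv`). Both frontiers thus reduce to one claim: the
least information compatible with errors `d` is `½ ∑ log (σⱼ² / dⱼ)`.

Both halves of the claim rest on one function, the log-density `logAllocRatio` of the backward
channel `⨂ N(zⱼ, dⱼ)` against the source. As a Donsker–Varadhan test function, with an estimate
`φ(Z)` in place of `z`, it yields the converse `ofReal_sum_log_le_klDiv` without any conditional law
of the source. As an actual joint density it defines the Gaussian test channel, for which the bound
is an equality (`IsTestChannel.klDiv_eq`). The channel output is scaled to a standard Gaussian: the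
reference measure is then the same for all allocations, and the channels of all queries form one
kernel.

For a single query, the inequality `log x ≤ x - 1` with Lagrange multiplier `1 / ν` shows that
water-filling is optimal, and strictness gives uniqueness (`sum_log_waterFill_le`). Choosing the
least water level makes the optimizer measurable in the query, so the pointwise optima can be
realized together and integrated. -/

namespace TaskCompression

/-! ### Divergence bounds and scalar Gaussian density ratios -/

/-- Donsker–Varadhan lower bound for a normalized exponential test function. -/
lemma ofReal_integral_le_klDiv {E : Type*} [MeasurableSpace E] {J ρ : Measure E}
    [IsProbabilityMeasure J] [IsProbabilityMeasure ρ] {f : E → ℝ} (hf : Measurable f)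
    (hfJ : Integrable f J) (hR : ∫⁻ x, ENNReal.ofReal (Real.exp (f x)) ∂ρ = 1) :
    ENNReal.ofReal (∫ x, f x ∂J) ≤ InformationTheory.klDiv J ρ := by
  have hint : Integrable (fun x => Real.exp (f x)) ρ := by
    rw [← lintegral_ofReal_ne_top_iff_integrable (by fun_prop)
      (ae_of_all _ fun x => (Real.exp_pos _).le), hR]
    exact ENNReal.one_ne_top
  have hone : ∫ x, Real.exp (f x) ∂ρ = 1 := by
    rw [integral_eq_lintegral_of_nonneg_ae (ae_of_all _ fun x => (Real.exp_pos _).le)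
      (by fun_prop), hR]
    simp
  by_cases h : J ≪ ρ ∧ Integrable (llr J ρ) J
  swap
  · rw [← InformationTheory.klDiv_ne_top_iff, not_not] at h
    simp [h]
  obtain ⟨hac, hll⟩ := h
  have hprob := isProbabilityMeasure_tilted hint
  have hac' : J ≪ ρ.tilted f := hac.trans (absolutelyContinuous_tilted hint)
  -- The divergence of `J` from the tilted measure is nonnegative; it equals the divergence from `ρ`
  -- minus the mean of `f`, as the normalizing constant is 1.
  have hnn := InformationTheory.integral_llr_add_sub_measure_univ_nonneg hac'
    (integrable_llr_tilted_right hac hfJ hll hint)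
  rw [integral_llr_tilted_right hac hfJ hint hll, hone] at hnn
  rw [InformationTheory.klDiv_of_ac_of_integrable hac hll]
  apply ENNReal.ofReal_le_ofReal
  simp at hnn ⊢
  linarith

/-- Divergence of a normalized exponential tilt from its base measure. -/
lemma klDiv_withDensity_exp {E : Type*} [MeasurableSpace E] {ρ : Measure E}
    [IsProbabilityMeasure ρ] {f : E → ℝ} (hf : Measurable f)
    (hR : ∫⁻ x, ENNReal.ofReal (Real.exp (f x)) ∂ρ = 1)
    (hfJ : Integrable f (ρ.withDensity fun x => ENNReal.ofReal (Real.exp (f x)))) :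
    InformationTheory.klDiv (ρ.withDensity fun x => ENNReal.ofReal (Real.exp (f x))) ρ =
      ENNReal.ofReal (∫ x, f x ∂(ρ.withDensity fun x => ENNReal.ofReal (Real.exp (f x)))) := by
  set J := ρ.withDensity fun x => ENNReal.ofReal (Real.exp (f x)) with hJ
  have hac : J ≪ ρ := withDensity_absolutelyContinuous _ _
  have hprob : IsProbabilityMeasure J := ⟨by rw [hJ, withDensity_apply _ .univ]; simpa using hR⟩
  have hll : llr J ρ =ᵐ[J] f := by
    filter_upwards [hac.ae_le (Measure.rnDeriv_withDensity ρ
      (f := fun x => ENNReal.ofReal (Real.exp (f x))) (by fun_prop))] with x hx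
    rw [llr, hx, ENNReal.toReal_ofReal (Real.exp_pos _).le, Real.log_exp]
  rw [InformationTheory.klDiv_of_ac_of_integrable hac ((integrable_congr hll).2 hfJ),
    integral_congr_ae hll]
  simp

/-- Logarithm of the density at `s` of `N(z, D)` with respect to `N(0, v)`; it vanishes for
`v = D = 0`. -/
noncomputable def logGaussianRatio (v D z s : ℝ) : ℝ :=
  Real.log (v / D) / 2 + s ^ 2 / (2 * v) - (s - z) ^ 2 / (2 * D)

@[fun_prop]
lemma measurable_logGaussianRatio {E : Type*} [MeasurableSpace E] {v D z s : E → ℝ}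
    (hv : Measurable v) (hD : Measurable D) (hz : Measurable z) (hs : Measurable s) :
    Measurable fun x => logGaussianRatio (v x) (D x) (z x) (s x) := by
  unfold logGaussianRatio
  fun_prop

lemma exp_half_log {x : ℝ} (hx : 0 < x) : Real.exp (Real.log x / 2) = √x := by
  rw [Real.sqrt_eq_rpow, Real.rpow_def_of_pos hx]
  congr 1; ring

lemma gaussianPDFReal_mul_exp_logGaussianRatio {v D : ℝ≥0} (hv : v ≠ 0) (hD : D ≠ 0) (z s : ℝ) :
    gaussianPDFReal 0 v s * Real.exp (logGaussianRatio v D z s) = gaussianPDFReal z D s := by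
  have hv' : (0 : ℝ) < v := by positivity
  have hD' : (0 : ℝ) < D := by positivity
  have e : -(s - 0) ^ 2 / (2 * (v : ℝ)) + (Real.log (v / D) / 2 + s ^ 2 / (2 * v)
      - (s - z) ^ 2 / (2 * D)) = Real.log (v / D) / 2 + -(s - z) ^ 2 / (2 * D) := by
    ring
  rw [gaussianPDFReal, gaussianPDFReal, logGaussianRatio, mul_assoc, ← Real.exp_add, e,
    Real.exp_add, exp_half_log (by positivity), ← mul_assoc]
  congr 1
  rw [Real.sqrt_div hv'.le, Real.sqrt_mul (x := 2 * Real.pi) (by positivity) v,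
    Real.sqrt_mul (x := 2 * Real.pi) (by positivity) D]
  have := Real.sqrt_pos.2 hv'
  field_simp

lemma lintegral_exp_logGaussianRatio_mul {v D : ℝ≥0} (hv : v ≠ 0) (hD : D ≠ 0) (z : ℝ)
    {F : ℝ → ℝ≥0∞} (hF : Measurable F) :
    ∫⁻ s, ENNReal.ofReal (Real.exp (logGaussianRatio v D z s)) * F s ∂gaussianReal 0 v =
      ∫⁻ s, F s ∂gaussianReal z D := by
  rw [gaussianReal_of_var_ne_zero _ hv, gaussianReal_of_var_ne_zero _ hD,
    lintegral_withDensity_eq_lintegral_mul _ (by fun_prop) (by fun_prop),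
    lintegral_withDensity_eq_lintegral_mul _ (by fun_prop) (by fun_prop)]
  refine lintegral_congr fun s => ?_
  simp only [Pi.mul_apply, gaussianPDF]
  rw [← mul_assoc, ← ENNReal.ofReal_mul (gaussianPDFReal_nonneg _ _ _),
    gaussianPDFReal_mul_exp_logGaussianRatio hv hD]

/-- `N(z, D)` is normalized. -/
lemma lintegral_exp_logGaussianRatio {v D : ℝ≥0} (hD : D = 0 → v = 0) (hv : v = 0 → D = 0)
    (z : ℝ) :
    ∫⁻ s, ENNReal.ofReal (Real.exp (logGaussianRatio v D z s)) ∂gaussianReal 0 v = 1 := by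
  by_cases h : v = 0
  · simp [h, hv h, logGaussianRatio]
  · simpa using lintegral_exp_logGaussianRatio_mul h (mt hD h) z (F := fun _ => 1) (by fun_prop)

lemma lintegral_sq_sub_gaussianReal (z : ℝ) (v : ℝ≥0) :
    ∫⁻ s, ENNReal.ofReal ((s - z) ^ 2) ∂gaussianReal z v = v := by
  have h := (memLp_id_gaussianReal (μ := z) (v := v) 2).ofReal_variance_eq
  simp only [variance_id_gaussianReal, evariance_eq_lintegral_ofReal, id] at h
  simpa using h.symm

/-- The mean squared deviation from `z` under `N(z, D)`. -/
lemma lintegral_exp_logGaussianRatio_mul_sq {v D : ℝ≥0} (hD : D = 0 → v = 0) (hv : v = 0 → D = 0)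
    {z : ℝ} (hz : v = 0 → z = 0) :
    ∫⁻ s, ENNReal.ofReal (Real.exp (logGaussianRatio v D z s)) * ENNReal.ofReal ((s - z) ^ 2)
      ∂gaussianReal 0 v = D := by
  by_cases h : v = 0
  · simp [h, hv h, hz h]
  · rw [lintegral_exp_logGaussianRatio_mul h (mt hD h) z (by fun_prop),
      lintegral_sq_sub_gaussianReal]

/-- Mixing `N(√(v - D) w, D)` over a standard Gaussian `w` gives `N(0, v)`. -/
lemma lintegral_exp_logGaussianRatio_mixture {v D : ℝ≥0} (hD : D = 0 → v = 0) (hDv : D ≤ v)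
    (s : ℝ) :
    ∫⁻ w, ENNReal.ofReal (Real.exp (logGaussianRatio v D (√(v - D) * w) s)) ∂gaussianReal 0 1
      = 1 := by
  by_cases h : v = 0
  · have : D = 0 := by simpa [h] using hDv
    simp [h, this, logGaussianRatio]
  have hD0 : D ≠ 0 := mt hD h
  have hv' : (0 : ℝ) < v := by positivity
  have hD' : (0 : ℝ) < D := by positivity
  have hle : (D : ℝ) ≤ v := hDv
  -- Bayes' rule: if `w` is standard and `s` given `w` is `N(√(v - D) w, D)`, then `w` given `s` is
  -- `N(√(v - D) s / v, D / v)`. Either conditional yields the same density of the joint law against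
  -- the product of marginals, so the mixture integral is a normalization in `w`.
  have key : ∀ w, logGaussianRatio v D (√(v - D) * w) s =
      logGaussianRatio (1 : ℝ≥0) (D / v : ℝ≥0) (√(v - D) * s / v) w := by
    intro w
    have hs := Real.sq_sqrt (sub_nonneg.2 hle)
    simp only [logGaussianRatio]
    push_cast
    have e1 : (1 : ℝ) / (D / v) = v / D := by field_simp
    rw [e1, add_sub_assoc, add_sub_assoc]
    congr 1
    field_simp
    linear_combination (s ^ 2 - w ^ 2 * v) * hs
  simp_rw [key]
  exact lintegral_exp_logGaussianRatio (by simp [hD0, h]) (by simp) _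

end TaskCompression

namespace TaskCompression

/-! ### Product Gaussian sources and allocations -/

lemma lintegral_pi_prod {ι : Type*} [Fintype ι] {E : ι → Type*} [∀ i, MeasurableSpace (E i)]
    (μ : ∀ i, Measure (E i)) [∀ i, IsProbabilityMeasure (μ i)] {f : ∀ i, E i → ℝ≥0∞}
    (hf : ∀ i, Measurable (f i)) :
    ∫⁻ x, ∏ i, f i (x i) ∂Measure.pi μ = ∏ i, ∫⁻ x, f i x ∂μ i := by
  rw [lintegral_prod_eq_prod_lintegral_of_indepFun (μ := Measure.pi μ) Finset.univ
    (fun i (x : ∀ i, E i) => f i (x i)) (iIndepFun_pi fun i => (hf i).aemeasurable) fun i => (hf i).comp (measurable_pi_apply i)]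
  refine Finset.prod_congr rfl fun i _ => ?_
  exact (measurePreserving_eval μ i).lintegral_comp (hf i)

variable {m : ℕ}

/-- The law of independent centred Gaussian coordinates with standard deviations `σ`. -/
noncomputable def gaussianSource (σ : Fin m → ℝ≥0) : Measure (Fin m → ℝ) :=
  Measure.pi fun j => gaussianReal 0 (σ j ^ 2)

instance (σ : Fin m → ℝ≥0) : IsProbabilityMeasure (gaussianSource σ) := by
  unfold gaussianSource; infer_instance

/-- Allocations `0 ≤ dⱼ ≤ σⱼ²` of finite rate. -/
def FiniteAllocation (σ : Fin m → ℝ≥0) (d : Fin m → ℝ) : Prop :=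
  ∀ j, 0 ≤ d j ∧ d j ≤ (σ j : ℝ) ^ 2 ∧ (d j = 0 → σ j = 0)

/-- Logarithm of the density at `s` of `⨂ⱼ N(zⱼ, dⱼ)` with respect to `gaussianSource σ`. -/
noncomputable def logAllocRatio (σ : Fin m → ℝ≥0) (d z s : Fin m → ℝ) : ℝ :=
  ∑ j, logGaussianRatio ((σ j : ℝ) ^ 2) (d j) (z j) (s j)

@[fun_prop]
lemma measurable_logAllocRatio {E : Type*} [MeasurableSpace E] (σ : Fin m → ℝ≥0)
    {d z s : E → Fin m → ℝ} (hd : Measurable d) (hz : Measurable z) (hs : Measurable s) :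
    Measurable fun x => logAllocRatio σ (d x) (z x) (s x) := by
  unfold logAllocRatio
  fun_prop

lemma ofReal_exp_logAllocRatio (σ : Fin m → ℝ≥0) (d z s : Fin m → ℝ) :
    ENNReal.ofReal (Real.exp (logAllocRatio σ d z s)) =
      ∏ j, ENNReal.ofReal (Real.exp (logGaussianRatio ((σ j : ℝ) ^ 2) (d j) (z j) (s j))) := by
  rw [logAllocRatio, Real.exp_sum, ENNReal.ofReal_prod_of_nonneg fun _ _ => (Real.exp_pos _).le]

lemma lintegral_exp_logAllocRatio {σ : Fin m → ℝ≥0} {d : Fin m → ℝ} (hd : FiniteAllocation σ d)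
    (z : Fin m → ℝ) :
    ∫⁻ s, ENNReal.ofReal (Real.exp (logAllocRatio σ d z s)) ∂gaussianSource σ = 1 := by
  lift d to Fin m → ℝ≥0 using fun j => (hd j).1
  simp_rw [ofReal_exp_logAllocRatio]
  rw [gaussianSource, lintegral_pi_prod _ (f := fun j s =>
    ENNReal.ofReal (Real.exp (logGaussianRatio ((σ j : ℝ) ^ 2) (d j) (z j) s))) (by fun_prop)]
  refine Finset.prod_eq_one fun j _ => ?_
  obtain ⟨-, h2, h3⟩ := hd j
  have h2' : d j ≤ σ j ^ 2 := by exact_mod_cast h2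
  have := lintegral_exp_logGaussianRatio (v := σ j ^ 2) (D := d j)
    (fun h => by simp [h3 (by simp [h])]) (fun h => by simpa [h] using h2') (z j)
  simpa using this

/-- Under the density the other coordinates integrate to 1 and coordinate `j` is `N(zⱼ, dⱼ)`. For `σ
j = 0` the measure stays a point mass at 0 whatever `z j` is, which forces the condition `hz`. -/
lemma lintegral_exp_logAllocRatio_mul_sq {σ : Fin m → ℝ≥0} {d : Fin m → ℝ}
    (hd : FiniteAllocation σ d) {z : Fin m → ℝ} (j : Fin m) (hz : σ j = 0 → z j = 0) :
    ∫⁻ s, ENNReal.ofReal (Real.exp (logAllocRatio σ d z s)) * ENNReal.ofReal ((z j - s j) ^ 2)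
      ∂gaussianSource σ = ENNReal.ofReal (d j) := by
  lift d to Fin m → ℝ≥0 using fun j => (hd j).1
  have hcond : ∀ i, (d i = 0 → σ i ^ 2 = 0) ∧ (σ i ^ 2 = 0 → d i = 0) := by
    intro i
    obtain ⟨-, h2, h3⟩ := hd i
    have h2' : d i ≤ σ i ^ 2 := by exact_mod_cast h2
    exact ⟨fun h => by simp [h3 (by simp [h])], fun h => by simpa [h] using h2'⟩
  have hprod : ∀ s : Fin m → ℝ,
      ENNReal.ofReal (Real.exp (logAllocRatio σ (fun j => d j) z s)) *
        ENNReal.ofReal ((z j - s j) ^ 2) =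
      ∏ i, (ENNReal.ofReal (Real.exp (logGaussianRatio ((σ i : ℝ) ^ 2) (d i) (z i) (s i))) *
        if i = j then ENNReal.ofReal ((s i - z i) ^ 2) else 1) := by
    intro s
    rw [Finset.prod_mul_distrib, ofReal_exp_logAllocRatio]
    simp only [Finset.prod_ite_eq', Finset.mem_univ, if_true]
    rw [sub_sq_comm]
  simp_rw [hprod]
  rw [gaussianSource, lintegral_pi_prod _ (f := fun i s =>
    ENNReal.ofReal (Real.exp (logGaussianRatio ((σ i : ℝ) ^ 2) (d i) (z i) s)) *
        if i = j then ENNReal.ofReal ((s - z i) ^ 2) else 1) (fun i => by split_ifs <;> fun_prop),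
    Finset.prod_eq_single j]
  · have := lintegral_exp_logGaussianRatio_mul_sq (v := σ j ^ 2) (D := d j) (z := z j)
      (hcond j).1 (hcond j).2 (fun h => hz (by simpa using h))
    simpa using this
  · intro i _ hij
    have := lintegral_exp_logGaussianRatio (v := σ i ^ 2) (D := d i)
      (hcond i).1 (hcond i).2 (z i)
    simpa [hij] using this
  · simp

/-- The scaling that turns standard Gaussian coordinates into coordinates of variance
`σⱼ² - dⱼ`. -/
noncomputable def reconstruct (σ : Fin m → ℝ≥0) (d w : Fin m → ℝ) (j : Fin m) : ℝ :=
  √((σ j : ℝ) ^ 2 - d j) * w j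

@[fun_prop]
lemma measurable_reconstruct {E : Type*} [MeasurableSpace E] (σ : Fin m → ℝ≥0)
    {d w : E → Fin m → ℝ} (hd : Measurable d) (hw : Measurable w) :
    Measurable fun x => reconstruct σ (d x) (w x) := by
  unfold reconstruct
  fun_prop

lemma reconstruct_eq_zero {σ : Fin m → ℝ≥0} {d : Fin m → ℝ} (hd : FiniteAllocation σ d)
    (w : Fin m → ℝ) {j : Fin m} (hj : σ j = 0) : reconstruct σ d w j = 0 := by
  have := (hd j).1
  rw [reconstruct, Real.sqrt_eq_zero_of_nonpos (by simpa [hj] using this), zero_mul]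

/-- This normalization in the output variable makes the test channel a Markov kernel. -/
lemma lintegral_exp_logAllocRatio_reconstruct {σ : Fin m → ℝ≥0} {d : Fin m → ℝ}
    (hd : FiniteAllocation σ d) (s : Fin m → ℝ) :
    ∫⁻ w, ENNReal.ofReal (Real.exp (logAllocRatio σ d (reconstruct σ d w) s))
      ∂gaussianSource (fun _ : Fin m => 1) = 1 := by
  lift d to Fin m → ℝ≥0 using fun j => (hd j).1
  simp_rw [ofReal_exp_logAllocRatio, reconstruct]
  rw [gaussianSource, lintegral_pi_prod _ (f := fun j w => ENNReal.ofReal (Real.exp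
    (logGaussianRatio ((σ j : ℝ) ^ 2) (d j) (√((σ j : ℝ) ^ 2 - d j) * w) (s j)))) (by fun_prop)]
  refine Finset.prod_eq_one fun j _ => ?_
  obtain ⟨-, h2, h3⟩ := hd j
  have h2' : d j ≤ σ j ^ 2 := by exact_mod_cast h2
  have := lintegral_exp_logGaussianRatio_mixture (v := σ j ^ 2) (D := d j)
    (fun h => by simp [h3 (by simp [h])]) h2' (s j)
  simpa using this

lemma lintegral_sq_gaussianSource (σ : Fin m → ℝ≥0) (j : Fin m) :
    ∫⁻ s, ENNReal.ofReal (s j ^ 2) ∂gaussianSource σ = ENNReal.ofReal ((σ j : ℝ) ^ 2) := by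
  have h := (measurePreserving_eval (fun j => gaussianReal 0 (σ j ^ 2)) j).lintegral_comp
    (f := fun x => ENNReal.ofReal (x ^ 2)) (by fun_prop)
  have h2 := lintegral_sq_sub_gaussianReal 0 (σ j ^ 2)
  simp only [sub_zero] at h2
  rw [h2] at h
  refine h.trans ?_
  rw [← ENNReal.ofReal_coe_nnreal]
  simp

/-! ### Information lower bound from squared errors -/

section Joint

variable {𝒵 : Type*} [MeasurableSpace 𝒵] {J : Measure ((Fin m → ℝ) × 𝒵)}

lemma lintegral_sq_fst_eq {σ : Fin m → ℝ≥0} (hJ : J.fst = gaussianSource σ) (j : Fin m) :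
    ∫⁻ x, ENNReal.ofReal (x.1 j ^ 2) ∂J = ENNReal.ofReal ((σ j : ℝ) ^ 2) := by
  rw [← lintegral_sq_gaussianSource, ← hJ, Measure.fst, lintegral_map (by fun_prop) (by fun_prop)]

/-- Mean of the log-density ratio in terms of the squared errors of the estimator `φ`. -/
lemma integral_logAllocRatio [IsProbabilityMeasure J] {σ : Fin m → ℝ≥0}
    (hJ : J.fst = gaussianSource σ)
    (d : Fin m → ℝ) {φ : 𝒵 → Fin m → ℝ} (hφ : Measurable φ)
    (herr : ∀ j, ∫⁻ x, ENNReal.ofReal ((φ x.2 j - x.1 j) ^ 2) ∂J ≠ ∞) :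
    Integrable (fun x => logAllocRatio σ d (φ x.2) x.1) J ∧
      ∫ x, logAllocRatio σ d (φ x.2) x.1 ∂J =
        ∑ j, (Real.log ((σ j : ℝ) ^ 2 / d j) / 2 + (σ j : ℝ) ^ 2 / (2 * (σ j : ℝ) ^ 2)
          - (∫⁻ x, ENNReal.ofReal ((φ x.2 j - x.1 j) ^ 2) ∂J).toReal / (2 * d j)) := by
  have hi1 : ∀ j, Integrable (fun x : (Fin m → ℝ) × 𝒵 => x.1 j ^ 2) J := fun j => by
    rw [← lintegral_ofReal_ne_top_iff_integrable (by fun_prop)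
      (ae_of_all _ fun x => sq_nonneg _), lintegral_sq_fst_eq hJ]
    exact ENNReal.ofReal_ne_top
  have hi2 : ∀ j, Integrable (fun x : (Fin m → ℝ) × 𝒵 => (x.1 j - φ x.2 j) ^ 2) J := fun j => by
    rw [← lintegral_ofReal_ne_top_iff_integrable (by fun_prop)
      (ae_of_all _ fun x => sq_nonneg _)]
    simpa only [sub_sq_comm] using herr j
  have hI1 : ∀ j, ∫ x, x.1 j ^ 2 ∂J = (σ j : ℝ) ^ 2 := fun j => by
    rw [integral_eq_lintegral_of_nonneg_ae (ae_of_all _ fun x => sq_nonneg _) (by fun_prop),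
      lintegral_sq_fst_eq hJ, ENNReal.toReal_ofReal (sq_nonneg _)]
  have hI2 : ∀ j, ∫ x, (x.1 j - φ x.2 j) ^ 2 ∂J =
      (∫⁻ x, ENNReal.ofReal ((φ x.2 j - x.1 j) ^ 2) ∂J).toReal := fun j => by
    rw [integral_eq_lintegral_of_nonneg_ae (ae_of_all _ fun x => sq_nonneg _) (by fun_prop)]
    simp only [sub_sq_comm]
  have hc : ∀ j, Integrable (fun x : (Fin m → ℝ) × 𝒵 =>
      Real.log ((σ j : ℝ) ^ 2 / d j) / 2 + x.1 j ^ 2 / (2 * (σ j : ℝ) ^ 2)) J := fun j =>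
    (integrable_const _).add ((hi1 j).div_const _)
  have hg : ∀ j, Integrable (fun x : (Fin m → ℝ) × 𝒵 =>
      logGaussianRatio ((σ j : ℝ) ^ 2) (d j) (φ x.2 j) (x.1 j)) J := fun j =>
    (hc j).sub ((hi2 j).div_const _)
  refine ⟨integrable_finsetSum _ fun j _ => hg j, ?_⟩
  simp only [logAllocRatio]
  rw [integral_finsetSum _ fun j _ => hg j]
  refine Finset.sum_congr rfl fun j _ => ?_
  simp only [logGaussianRatio]
  rw [integral_sub (hc j) ((hi2 j).div_const _), integral_add (integrable_const _)
    ((hi1 j).div_const _), integral_div, integral_div, integral_div, hI1, hI2]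
  simp

/-- A representation from which the source can be estimated with squared errors at most `dⱼ`
carries information at least `½ ∑ⱼ log (σⱼ² / dⱼ)`. -/
lemma ofReal_sum_log_le_klDiv [IsProbabilityMeasure J] {σ : Fin m → ℝ≥0}
    (hJ : J.fst = gaussianSource σ)
    {d : Fin m → ℝ} (hd : FiniteAllocation σ d) {φ : 𝒵 → Fin m → ℝ} (hφ : Measurable φ)
    (herr : ∀ j, ∫⁻ x, ENNReal.ofReal ((φ x.2 j - x.1 j) ^ 2) ∂J ≤ ENNReal.ofReal (d j)) :
    ENNReal.ofReal (∑ j, Real.log ((σ j : ℝ) ^ 2 / d j) / 2) ≤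
      InformationTheory.klDiv J (J.fst.prod J.snd) := by
  obtain ⟨hint, hval⟩ := integral_logAllocRatio hJ d hφ
    fun j => ((herr j).trans_lt ENNReal.ofReal_lt_top).ne
  refine le_trans ?_ (ofReal_integral_le_klDiv (by fun_prop) hint ?_)
  · rw [hval]
    -- On a nondegenerate coordinate the two quadratic terms have mean `1/2 - e / (2 d)`,
    -- nonnegative because the error `e` is at most `d`.
    refine ENNReal.ofReal_le_ofReal (Finset.sum_le_sum fun j _ => ?_)
    have he : (∫⁻ x, ENNReal.ofReal ((φ x.2 j - x.1 j) ^ 2) ∂J).toReal ≤ d j :=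
      ENNReal.toReal_le_of_le_ofReal (hd j).1 (herr j)
    by_cases hσ : σ j = 0
    · have : d j = 0 := le_antisymm (by simpa [hσ] using (hd j).2.1) (hd j).1
      simp [hσ, this]
    · have hdj : 0 < d j := lt_of_le_of_ne (hd j).1 fun h => hσ ((hd j).2.2 h.symm)
      have h1 : (σ j : ℝ) ^ 2 / (2 * (σ j : ℝ) ^ 2) = 1 / 2 := by
        have : (σ j : ℝ) ≠ 0 := by exact_mod_cast hσ
        field_simp
      have h2 := div_le_div_of_nonneg_right he (by positivity : 0 ≤ 2 * d j)
      have h3 : d j / (2 * d j) = 1 / 2 := by field_simp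
      linarith
  -- Under the product of marginals the source is integrated first, with `z` fixed, and the backward
  -- density is normalized for every `z`.
  · rw [hJ, lintegral_prod_symm _ (by fun_prop)]
    simp [lintegral_exp_logAllocRatio hd]

end Joint

/-! ### Gaussian test channels -/

section Channel

variable {σ : Fin m → ℝ≥0} {d : Fin m → ℝ} {κ : Kernel (Fin m → ℝ) (Fin m → ℝ)}

/-- `κ` is the Gaussian test channel of the allocation `d`, with standardized output. -/
def IsTestChannel (σ : Fin m → ℝ≥0) (d : Fin m → ℝ) (κ : Kernel (Fin m → ℝ) (Fin m → ℝ)) : Prop :=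
  ∀ s, κ s = (gaussianSource fun _ => 1).withDensity fun w =>
    ENNReal.ofReal (Real.exp (logAllocRatio σ d (reconstruct σ d w) s))

lemma IsTestChannel.compProd_eq [IsMarkovKernel κ] (hκ : IsTestChannel σ d κ) :
    gaussianSource σ ⊗ₘ κ =
      ((gaussianSource σ).prod (gaussianSource fun _ => 1)).withDensity fun x =>
        ENNReal.ofReal (Real.exp (logAllocRatio σ d (reconstruct σ d x.2) x.1)) := by
  ext t ht
  rw [Measure.compProd_apply ht, withDensity_apply _ ht, ← lintegral_indicator ht,
    lintegral_prod _ (Measurable.aemeasurable (Measurable.indicator (by fun_prop) ht))]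
  refine lintegral_congr fun s => ?_
  rw [hκ s, withDensity_apply _ (measurable_prodMk_left ht),
    ← lintegral_indicator (measurable_prodMk_left ht)]
  rfl

/-- Integrating out the source at fixed `w` gives 1, so the output marginal is the reference
measure. The density of the joint law against the product of its marginals is therefore the
exponential of the converse's test function. -/
lemma IsTestChannel.snd_eq [IsMarkovKernel κ] (hd : FiniteAllocation σ d)
    (hκ : IsTestChannel σ d κ) : (gaussianSource σ ⊗ₘ κ).snd = gaussianSource fun _ => 1 := by
  ext t ht
  rw [Measure.snd_apply ht, hκ.compProd_eq, withDensity_apply _ (measurable_snd ht),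
    ← lintegral_indicator (measurable_snd ht), lintegral_prod_symm _
    (Measurable.aemeasurable (Measurable.indicator (by fun_prop) (measurable_snd ht)))]
  have : ∀ w, ∫⁻ s, (Prod.snd ⁻¹' t).indicator (fun x : (Fin m → ℝ) × (Fin m → ℝ) =>
      ENNReal.ofReal (Real.exp (logAllocRatio σ d (reconstruct σ d x.2) x.1))) (s, w)
        ∂gaussianSource σ = t.indicator 1 w := by
    intro w
    by_cases hw : w ∈ t
    · simpa [Set.indicator, hw] using lintegral_exp_logAllocRatio hd _
    · simp [Set.indicator, hw]
  simp_rw [this]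
  rw [lintegral_indicator_one ht]

lemma IsTestChannel.lintegral_sq [IsMarkovKernel κ] (hd : FiniteAllocation σ d)
    (hκ : IsTestChannel σ d κ) (j : Fin m) :
    ∫⁻ x, ENNReal.ofReal ((reconstruct σ d x.2 j - x.1 j) ^ 2) ∂(gaussianSource σ ⊗ₘ κ) =
      ENNReal.ofReal (d j) := by
  have hm : Measurable fun x : (Fin m → ℝ) × (Fin m → ℝ) => reconstruct σ d x.2 := by fun_prop
  rw [hκ.compProd_eq, lintegral_withDensity_eq_lintegral_mul _ (by fun_prop) (by fun_prop),
    lintegral_prod_symm _ (by fun_prop)]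
  simp [lintegral_exp_logAllocRatio_mul_sq hd j fun h => reconstruct_eq_zero hd _ h]

/-- The rate of the Gaussian test channel. -/
lemma IsTestChannel.klDiv_eq [IsMarkovKernel κ] (hd : FiniteAllocation σ d)
    (hκ : IsTestChannel σ d κ) :
    InformationTheory.klDiv (gaussianSource σ ⊗ₘ κ)
      ((gaussianSource σ).prod (gaussianSource σ ⊗ₘ κ).snd) =
      ENNReal.ofReal (∑ j, Real.log ((σ j : ℝ) ^ 2 / d j) / 2) := by
  obtain ⟨hint, hval⟩ := integral_logAllocRatio (J := gaussianSource σ ⊗ₘ κ) (σ := σ) (by simp) d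
    (φ := reconstruct σ d) (by fun_prop) fun j => by
      rw [hκ.lintegral_sq hd]; exact ENNReal.ofReal_ne_top
  rw [hκ.snd_eq hd, hκ.compProd_eq, klDiv_withDensity_exp (by fun_prop) _ _, ← hκ.compProd_eq, hval]
  · congr 1
    refine Finset.sum_congr rfl fun j _ => ?_
    rw [hκ.lintegral_sq hd, ENNReal.toReal_ofReal (hd j).1]
    by_cases hσ : σ j = 0
    · have : d j = 0 := le_antisymm (by simpa [hσ] using (hd j).2.1) (hd j).1
      simp [hσ, this]
    · have hdj : d j ≠ 0 := fun h => hσ ((hd j).2.2 h)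
      have : (σ j : ℝ) ≠ 0 := by exact_mod_cast hσ
      field_simp
      ring
  · rw [lintegral_prod_symm _ (by fun_prop)]
    simp [lintegral_exp_logAllocRatio hd]
  · rw [← hκ.compProd_eq]; exact hint

end Channel

end TaskCompression

namespace TaskCompression

/-! ### Continuity of the rate and the converse allocation -/

open Filter Topology

/-- The value `∞` at 0 is the two-sided limit, since `Real.log` depends only on absolute values.
Continuity in `ℝ≥0∞` serves the existence of minimizers, the limit `δ → 0` in the converse, and
measurability of the optimal rate. -/
lemma continuous_logPlusRatio {v : ℝ} (hv : 0 ≤ v) : Continuous (logPlusRatio v) := by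
  rcases hv.eq_or_lt with rfl | hv
  · have : logPlusRatio 0 = fun _ => 0 := by ext d; simp [logPlusRatio]
    rw [this]; exact continuous_const
  rw [continuous_iff_continuousAt]
  intro d
  by_cases hd : d = 0
  · subst hd
    rw [continuousAt_iff_punctured_nhds]
    have h0 : logPlusRatio v 0 = ∞ := by simp [logPlusRatio, hv]
    rw [h0]
    have h1 : Tendsto (fun d => max 0 (Real.log v - Real.log d)) (𝓝[≠] (0 : ℝ)) atTop :=
      tendsto_atTop_mono (fun _ => le_max_right _ _)
        (tendsto_atTop_add_const_left _ _ (tendsto_neg_atBot_atTop.comp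
          Real.tendsto_log_nhdsNE_zero))
    refine (ENNReal.tendsto_ofReal_atTop.comp h1).congr' ?_
    filter_upwards [self_mem_nhdsWithin] with x hx
    rw [Function.comp_apply, logPlusRatio, if_neg (by tauto), Real.log_div hv.ne' hx]
  · have h1 : ContinuousAt (fun d => ENNReal.ofReal (max 0 (Real.log (v / d)))) d :=
      ENNReal.continuous_ofReal.continuousAt.comp (continuousAt_const.max
        ((continuousAt_const.div continuousAt_id hd).log (div_ne_zero hv.ne' hd)))
    refine h1.congr ?_
    filter_upwards [isOpen_ne.mem_nhds hd] with x hx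
    rw [logPlusRatio, if_neg (by tauto)]

variable {m : ℕ} {σ : Fin m → ℝ≥0} {d : Fin m → ℝ}

lemma continuous_allocRate (σ : Fin m → ℝ≥0) : Continuous (allocRate σ) := by
  unfold allocRate
  refine (ENNReal.continuous_const_mul (by simp)).comp ?_
  exact continuous_finsetSum _ fun j _ =>
    (continuous_logPlusRatio (sq_nonneg _)).comp (continuous_apply j)

lemma FiniteAllocation.log_nonneg (hd : FiniteAllocation σ d) (j : Fin m) :
    0 ≤ Real.log ((σ j : ℝ) ^ 2 / d j) := by
  obtain ⟨h1, h2, h3⟩ := hd j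
  rcases h1.eq_or_lt with h | h
  · simp [← h]
  · exact Real.log_nonneg ((one_le_div h).2 h2)

lemma FiniteAllocation.allocRate_eq (hd : FiniteAllocation σ d) :
    allocRate σ d = ENNReal.ofReal (∑ j, Real.log ((σ j : ℝ) ^ 2 / d j) / 2) := by
  have h : ∀ j, logPlusRatio ((σ j : ℝ) ^ 2) (d j) =
      ENNReal.ofReal (Real.log ((σ j : ℝ) ^ 2 / d j)) := by
    intro j
    rw [logPlusRatio, if_neg, max_eq_right (hd.log_nonneg j)]
    rintro ⟨h1, h2⟩
    simp [(hd j).2.2 h2] at h1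
  simp_rw [allocRate, h]
  rw [← ENNReal.ofReal_sum_of_nonneg fun j _ => hd.log_nonneg j, ← Finset.sum_div,
    div_eq_inv_mul (b := (2 : ℝ)), ENNReal.ofReal_mul (by norm_num),
    ENNReal.ofReal_inv_of_pos (by norm_num)]
  simp

lemma finiteAllocation_of_allocRate_ne_top (hd : ∀ j, 0 ≤ d j ∧ d j ≤ (σ j : ℝ) ^ 2)
    (h : allocRate σ d ≠ ∞) : FiniteAllocation σ d := by
  refine fun j => ⟨(hd j).1, (hd j).2, fun h0 => ?_⟩
  by_contra hσ
  refine h ?_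
  rw [allocRate]
  refine ENNReal.mul_eq_top.2 (Or.inl ⟨by simp, ENNReal.sum_eq_top.2 ⟨j, Finset.mem_univ _, ?_⟩⟩)
  rw [logPlusRatio, if_pos ⟨by positivity, h0⟩]

lemma exists_isLeast_familyAllocations {𝒬 : Type*} (σ : Fin m → ℝ≥0) (α : 𝒬 → Fin m → ℝ) {ε : ℝ}
    (hε : 0 ≤ ε) :
    ∃ d ∈ familyAllocations σ α ε, IsMinOn (allocRate σ) (familyAllocations σ α ε) d := by
  have heq : familyAllocations σ α ε = (Set.univ.pi fun j => Set.Icc 0 ((σ j : ℝ) ^ 2)) ∩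
      ⋂ q, {d | ∑ j, α q j * d j ≤ ε} := by
    ext d; simp [familyAllocations, Pi.le_def, forall_and]
  refine IsCompact.exists_isMinOn ?_ ⟨0, ?_⟩ (continuous_allocRate σ).continuousOn
  · rw [heq]
    refine (isCompact_univ_pi fun j => isCompact_Icc).inter_right (isClosed_iInter fun q => ?_)
    exact isClosed_le (by fun_prop) continuous_const
  · simp [familyAllocations, hε]

section Joint

variable {𝒵 : Type*} [MeasurableSpace 𝒵] {J : Measure ((Fin m → ℝ) × 𝒵)}

lemma lintegral_quadLoss {a : Fin m → ℝ} (ha : ∀ j, 0 ≤ a j) {φ : 𝒵 → Fin m → ℝ}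
    (hφ : Measurable φ) :
    ∫⁻ x, ENNReal.ofReal (quadLoss a (φ x.2) x.1) ∂J =
      ∑ j, ENNReal.ofReal (a j) * ∫⁻ x, ENNReal.ofReal ((φ x.2 j - x.1 j) ^ 2) ∂J := by
  have h : ∀ x : (Fin m → ℝ) × 𝒵, ENNReal.ofReal (quadLoss a (φ x.2) x.1) =
      ∑ j, ENNReal.ofReal (a j) * ENNReal.ofReal ((φ x.2 j - x.1 j) ^ 2) := by
    intro x
    rw [quadLoss, ENNReal.ofReal_sum_of_nonneg fun j _ => mul_nonneg (ha j) (sq_nonneg _)]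
    exact Finset.sum_congr rfl fun j _ => ENNReal.ofReal_mul (ha j)
  simp_rw [h]
  rw [lintegral_finsetSum _ (by fun_prop)]
  exact Finset.sum_congr rfl fun j _ => lintegral_const_mul _ (by fun_prop)

/-- Converse: every representation induces an allocation (its minimal mean squared errors) that
is charged by the risk for all weights and has no larger rate. -/
lemma exists_allocation_le_klDiv [IsProbabilityMeasure J] (hJ : J.fst = gaussianSource σ) :
    ∃ d : Fin m → ℝ, (∀ j, 0 ≤ d j ∧ d j ≤ (σ j : ℝ) ^ 2) ∧
      (∀ a : Fin m → ℝ, (∀ j, 0 ≤ a j) → ∀ φ : 𝒵 → Fin m → ℝ, Measurable φ →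
        ENNReal.ofReal (∑ j, a j * d j) ≤ ∫⁻ x, ENNReal.ofReal (quadLoss a (φ x.2) x.1) ∂J) ∧
      allocRate σ d ≤ InformationTheory.klDiv J (J.fst.prod J.snd) := by
  set e : Fin m → ℝ≥0∞ := fun j => ⨅ (ψ : 𝒵 → ℝ) (_ : Measurable ψ),
    ∫⁻ x, ENNReal.ofReal ((ψ x.2 - x.1 j) ^ 2) ∂J with he
  have hzero : ∀ j, ∫⁻ x, ENNReal.ofReal (((0 : ℝ) - x.1 j) ^ 2) ∂J =
      ENNReal.ofReal ((σ j : ℝ) ^ 2) := fun j => by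
    simpa using lintegral_sq_fst_eq hJ j
  have hle : ∀ j, e j ≤ ENNReal.ofReal ((σ j : ℝ) ^ 2) := fun j =>
    (iInf₂_le (fun _ => (0 : ℝ)) measurable_const).trans (hzero j).le
  have hfin : ∀ j, e j ≠ ∞ := fun j => ((hle j).trans_lt ENNReal.ofReal_lt_top).ne
  have hbox : ∀ j, (e j).toReal ≤ (σ j : ℝ) ^ 2 := fun j =>
    ENNReal.toReal_le_of_le_ofReal (sq_nonneg _) (hle j)
  refine ⟨fun j => (e j).toReal, fun j => ⟨ENNReal.toReal_nonneg, hbox j⟩, ?_, ?_⟩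
  · intro a ha φ hφ
    rw [lintegral_quadLoss ha hφ, ENNReal.ofReal_sum_of_nonneg fun j _ =>
      mul_nonneg (ha j) ENNReal.toReal_nonneg]
    refine Finset.sum_le_sum fun j _ => ?_
    rw [ENNReal.ofReal_mul (ha j), ENNReal.ofReal_toReal (hfin j)]
    gcongr
    exact iInf₂_le (fun z => φ z j) (by fun_prop)
  -- The infimum `e j` need not be attained and may vanish while `σ j > 0`. Enlarging it by `δ`
  -- provides an actual estimator and a finite rate; the cap at `σ j ^ 2` is met by the zero
  -- estimator.
  · have hlim : Tendsto (fun δ : ℝ => fun j => min ((σ j : ℝ) ^ 2) ((e j).toReal + δ)) (𝓝[>] 0)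
        (𝓝 fun j => (e j).toReal) := by
      have hc : Continuous (fun δ : ℝ => fun j => min ((σ j : ℝ) ^ 2) ((e j).toReal + δ)) := by
        fun_prop
      have := (hc.tendsto 0).mono_left (nhdsWithin_le_nhds (s := Set.Ioi 0))
      simpa [hbox] using this
    refine le_of_tendsto (((continuous_allocRate σ).tendsto _).comp hlim) ?_
    filter_upwards [self_mem_nhdsWithin] with δ hδ
    have hδ : 0 < δ := hδ
    have hpos : ∀ j, 0 < (e j).toReal + δ := fun j => by positivity
    have hfa : FiniteAllocation σ fun j => min ((σ j : ℝ) ^ 2) ((e j).toReal + δ) := by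
      refine fun j => ⟨le_min (sq_nonneg _) (hpos j).le, min_le_left _ _, fun h => ?_⟩
      replace h : min ((σ j : ℝ) ^ 2) ((e j).toReal + δ) = 0 := h
      rcases min_choice ((σ j : ℝ) ^ 2) ((e j).toReal + δ) with h' | h'
      · rw [h'] at h; simpa using h
      · rw [h'] at h; exact absurd h (hpos j).ne'
    have hψ : ∀ j, ∃ ψ : 𝒵 → ℝ, Measurable ψ ∧ ∫⁻ x, ENNReal.ofReal ((ψ x.2 - x.1 j) ^ 2) ∂J ≤
        ENNReal.ofReal (min ((σ j : ℝ) ^ 2) ((e j).toReal + δ)) := by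
      intro j
      rcases le_total ((σ j : ℝ) ^ 2) ((e j).toReal + δ) with h | h
      · exact ⟨fun _ => 0, measurable_const, by rw [min_eq_left h]; exact (hzero j).le⟩
      · rw [min_eq_right h]
        have hlt : e j < ENNReal.ofReal ((e j).toReal + δ) := by
          rw [ENNReal.lt_ofReal_iff_toReal_lt (hfin j)]
          linarith
        obtain ⟨ψ, hlt⟩ := iInf_lt_iff.1 hlt
        obtain ⟨hψ, hlt⟩ := iInf_lt_iff.1 hlt
        exact ⟨ψ, hψ, hlt.le⟩
    choose ψ hψm hψe using hψ
    rw [Function.comp_apply, hfa.allocRate_eq]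
    exact ofReal_sum_log_le_klDiv hJ hfa (φ := fun z j => ψ j z) (by fun_prop) hψe

end Joint

end TaskCompression

namespace TaskCompression

/-! ### Weighted reverse water-filling -/

variable {m : ℕ} {σ : Fin m → ℝ≥0} {a d : Fin m → ℝ} {ε ν : ℝ}

lemma mul_waterFill (ha : ∀ j, 0 ≤ a j) (hν : 0 ≤ ν) (j : Fin m) :
    a j * waterFill σ a ν j = min (a j * (σ j : ℝ) ^ 2) ν := by
  rw [waterFill]
  split_ifs with h
  · simp [h, hν]
  · rw [mul_min_of_nonneg _ _ (ha j), mul_div_cancel₀ _ h]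

lemma waterFill_nonneg (ha : ∀ j, 0 ≤ a j) (hν : 0 ≤ ν) (j : Fin m) : 0 ≤ waterFill σ a ν j := by
  rw [waterFill]
  split_ifs with h
  · positivity
  · exact le_min (sq_nonneg _) (div_nonneg hν (ha j))

lemma waterFill_le (j : Fin m) : waterFill σ a ν j ≤ (σ j : ℝ) ^ 2 := by
  rw [waterFill]
  split_ifs with h
  · exact le_rfl
  · exact min_le_left _ _

/-- The inactive regime also becomes an equality of sums: termwise `waterFill` is at most `σⱼ²`, so
equal weighted sums force equality wherever `a j ≠ 0`, and elsewhere it holds by definition. -/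
lemma isWaterLevel_iff (ha : ∀ j, 0 ≤ a j) :
    IsWaterLevel σ a ε ν ↔
      0 ≤ ν ∧ ∑ j, a j * waterFill σ a ν j = min ε (∑ j, a j * (σ j : ℝ) ^ 2) := by
  constructor
  · rintro ⟨h0, h1, h2⟩
    refine ⟨h0, ?_⟩
    rcases le_or_gt ε (∑ j, a j * (σ j : ℝ) ^ 2) with h | h
    · rw [h1 h, min_eq_left h]
    · rw [min_eq_right h.le]
      exact Finset.sum_congr rfl fun j _ => by rw [h2 h j]
  · rintro ⟨h0, h1⟩
    refine ⟨h0, fun h => by rw [h1, min_eq_left h], fun h j => ?_⟩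
    rw [min_eq_right h.le] at h1
    have := (Finset.sum_eq_sum_iff_of_le fun j _ =>
      mul_le_mul_of_nonneg_left (waterFill_le (σ := σ) (ν := ν) j) (ha j)).1 h1 j
        (Finset.mem_univ j)
    by_cases haj : a j = 0
    · simp [waterFill, haj]
    · exact mul_left_cancel₀ haj this

/-- The least level at which water-filling uses up the tolerance. -/
noncomputable def waterLevel (σ : Fin m → ℝ≥0) (a : Fin m → ℝ) (ε : ℝ) : ℝ :=
  sInf {ν | 0 ≤ ν ∧ min ε (∑ j, a j * (σ j : ℝ) ^ 2) ≤ ∑ j, min (a j * (σ j : ℝ) ^ 2) ν}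

lemma exists_sum_min_eq (σ : Fin m → ℝ≥0) (ha : ∀ j, 0 ≤ a j) (hε : 0 ≤ ε) :
    ∃ ν, 0 ≤ ν ∧ ∑ j, min (a j * (σ j : ℝ) ^ 2) ν = min ε (∑ j, a j * (σ j : ℝ) ^ 2) := by
  have hnn : ∀ j, 0 ≤ a j * (σ j : ℝ) ^ 2 := fun j => mul_nonneg (ha j) (sq_nonneg _)
  have hM : 0 ≤ ∑ j, a j * (σ j : ℝ) ^ 2 := Finset.sum_nonneg fun j _ => hnn j
  have hc : Continuous fun ν => ∑ j, min (a j * (σ j : ℝ) ^ 2) ν := by fun_prop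
  have h0 : ∑ j, min (a j * (σ j : ℝ) ^ 2) 0 = 0 := Finset.sum_eq_zero fun j _ => by simp [hnn j]
  have h1 : ∑ j, min (a j * (σ j : ℝ) ^ 2) (∑ j, a j * (σ j : ℝ) ^ 2) =
      ∑ j, a j * (σ j : ℝ) ^ 2 := Finset.sum_congr rfl fun j _ =>
    min_eq_left (Finset.single_le_sum (f := fun j => a j * (σ j : ℝ) ^ 2) (fun j _ => hnn j)
      (Finset.mem_univ j))
  obtain ⟨ν, hν, hν'⟩ := intermediate_value_Icc hM hc.continuousOn
    (show min ε (∑ j, a j * (σ j : ℝ) ^ 2) ∈ Set.Icc _ _ by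
      simp only [h0, h1]; exact ⟨le_min hε hM, min_le_right _ _⟩)
  exact ⟨ν, hν.1, hν'⟩

lemma waterLevel_mem (σ : Fin m → ℝ≥0) (ha : ∀ j, 0 ≤ a j) (hε : 0 ≤ ε) :
    0 ≤ waterLevel σ a ε ∧
      min ε (∑ j, a j * (σ j : ℝ) ^ 2) ≤ ∑ j, min (a j * (σ j : ℝ) ^ 2) (waterLevel σ a ε) := by
  obtain ⟨ν, hν, h⟩ := exists_sum_min_eq σ ha hε
  refine IsClosed.csInf_mem (s := {ν | 0 ≤ ν ∧ min ε (∑ j, a j * (σ j : ℝ) ^ 2) ≤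
    ∑ j, min (a j * (σ j : ℝ) ^ 2) ν}) ?_ ⟨ν, hν, h.ge⟩ ⟨0, fun x hx => hx.1⟩
  have hc : Continuous fun ν => ∑ j, min (a j * (σ j : ℝ) ^ 2) ν := by fun_prop
  exact (isClosed_le continuous_const continuous_id).inter (isClosed_le continuous_const hc)

/-- The weighted sum is monotone in the level, so sublevel sets of the least level are cut out by
explicit inequalities in the weights. This gives measurability in the query. -/
lemma waterLevel_le_iff (σ : Fin m → ℝ≥0) (ha : ∀ j, 0 ≤ a j) (hε : 0 ≤ ε) {t : ℝ} :
    waterLevel σ a ε ≤ t ↔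
      0 ≤ t ∧ min ε (∑ j, a j * (σ j : ℝ) ^ 2) ≤ ∑ j, min (a j * (σ j : ℝ) ^ 2) t := by
  obtain ⟨h0, h1⟩ := waterLevel_mem σ ha hε
  refine ⟨fun h => ⟨h0.trans h, h1.trans ?_⟩, fun h => csInf_le ⟨0, fun x hx => hx.1⟩ h⟩
  gcongr

lemma isWaterLevel_waterLevel (σ : Fin m → ℝ≥0) (ha : ∀ j, 0 ≤ a j) (hε : 0 ≤ ε) :
    IsWaterLevel σ a ε (waterLevel σ a ε) := by
  obtain ⟨h0, h1⟩ := waterLevel_mem σ ha hε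
  obtain ⟨ν, hν, h⟩ := exists_sum_min_eq σ ha hε
  have hle := (waterLevel_le_iff σ ha hε).2 ⟨hν, h.ge⟩
  rw [isWaterLevel_iff ha]
  refine ⟨h0, ?_⟩
  simp_rw [mul_waterFill ha h0]
  refine le_antisymm ?_ h1
  rw [← h]
  gcongr

lemma measurable_waterFill_waterLevel {𝒬 : Type*} [MeasurableSpace 𝒬] (σ : Fin m → ℝ≥0)
    {α : 𝒬 → Fin m → ℝ} (hα : ∀ q j, 0 ≤ α q j) (hαm : Measurable α) (hε : 0 ≤ ε) :
    Measurable fun q => waterFill σ (α q) (waterLevel σ (α q) ε) := by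
  have hν : Measurable fun q => waterLevel σ (α q) ε := by
    refine measurable_of_Iic fun t => ?_
    have : (fun q => waterLevel σ (α q) ε) ⁻¹' Set.Iic t = {q | 0 ≤ t ∧
        min ε (∑ j, α q j * (σ j : ℝ) ^ 2) ≤ ∑ j, min (α q j * (σ j : ℝ) ^ 2) t} := by
      ext q
      exact waterLevel_le_iff σ (hα q) hε
    rw [this]
    have h1 : Measurable fun q => min ε (∑ j, α q j * (σ j : ℝ) ^ 2) := by fun_prop
    have h2 : Measurable fun q => ∑ j, min (α q j * (σ j : ℝ) ^ 2) t := by fun_prop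
    exact (MeasurableSet.const _).inter (measurableSet_le h1 h2)
  refine measurable_pi_lambda _ fun j => ?_
  have hj : Measurable fun q => α q j := by fun_prop
  exact Measurable.ite (hj (measurableSet_singleton 0)) measurable_const
    (measurable_const.min (hν.div hj))

lemma waterFill_mem (ha : ∀ j, 0 ≤ a j) (h : IsWaterLevel σ a ε ν) :
    waterFill σ a ν ∈ queryAllocations σ a ε := by
  obtain ⟨h0, h1⟩ := (isWaterLevel_iff ha).1 h
  exact ⟨fun j => ⟨waterFill_nonneg ha h0 j, waterFill_le j⟩, h1.trans_le (min_le_left _ _)⟩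

lemma sum_mul_le_sum_mul_waterFill (ha : ∀ j, 0 ≤ a j) (h : IsWaterLevel σ a ε ν)
    (hd : d ∈ queryAllocations σ a ε) : ∑ j, a j * d j ≤ ∑ j, a j * waterFill σ a ν j := by
  rw [((isWaterLevel_iff ha).1 h).2]
  exact le_min hd.2 (Finset.sum_le_sum fun j _ => mul_le_mul_of_nonneg_left (hd.1 j).2 (ha j))

/-- The only danger is level 0. There the total charge is 0, so every feasible `d` vanishes on the
charged coordinates, and finite rate of `d` forces `σ j = 0` on them. -/
lemma finiteAllocation_waterFill (ha : ∀ j, 0 ≤ a j) (h : IsWaterLevel σ a ε ν)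
    (hd : d ∈ queryAllocations σ a ε) (hfin : FiniteAllocation σ d) :
    FiniteAllocation σ (waterFill σ a ν) := by
  refine fun j => ⟨waterFill_nonneg ha h.1 j, waterFill_le j, fun hj => ?_⟩
  by_cases haj : a j = 0
  · simpa [waterFill, haj] using hj
  rcases h.1.eq_or_lt with hν | hν
  · have hs := sum_mul_le_sum_mul_waterFill ha h hd
    have hz : ∑ j, a j * waterFill σ a ν j = 0 := Finset.sum_eq_zero fun i _ => by
      rw [mul_waterFill ha h.1, ← hν]
      exact min_eq_right (mul_nonneg (ha i) (sq_nonneg _))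
    rw [hz] at hs
    have hnn : ∀ i ∈ Finset.univ, 0 ≤ a i * d i := fun i _ => mul_nonneg (ha i) (hd.1 i).1
    have := (Finset.sum_eq_zero_iff_of_nonneg hnn).1 (le_antisymm hs (Finset.sum_nonneg hnn)) j
      (Finset.mem_univ j)
    exact (hfin j).2.2 ((mul_eq_zero.1 this).resolve_left haj)
  · by_contra hσ
    have : 0 < waterFill σ a ν j := by
      rw [waterFill, if_neg haj]
      exact lt_min (by positivity) (div_pos hν (lt_of_le_of_ne (ha j) (Ne.symm haj)))
    exact this.ne' hj

/-- Tangent inequality for one coordinate of the rate at the water-filling allocation. -/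
lemma sub_div_waterFill_le (ha : ∀ j, 0 ≤ a j) (j : Fin m) (hdj : d j ≤ (σ j : ℝ) ^ 2)
    (hpos : 0 < waterFill σ a ν j) :
    d j / waterFill σ a ν j - 1 ≤ ν⁻¹ * (a j * d j - a j * waterFill σ a ν j) := by
  have e : d j / waterFill σ a ν j - 1 = (waterFill σ a ν j)⁻¹ * (d j - waterFill σ a ν j) := by
    field_simp
  rw [e, ← mul_sub, ← mul_assoc]
  -- Stationarity reads `1 / waterFill = a / ν` on uncapped coordinates. On capped or unweighted
  -- ones only `1 / waterFill ≥ a / ν` is available, which suffices because there `d j ≤ waterFill`.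
  by_cases haj : a j = 0
  · have hw : waterFill σ a ν j = (σ j : ℝ) ^ 2 := by simp [waterFill, haj]
    rw [haj, mul_zero, zero_mul]
    exact mul_nonpos_of_nonneg_of_nonpos (by positivity) (by rw [hw]; linarith)
  have haj' : 0 < a j := lt_of_le_of_ne (ha j) (Ne.symm haj)
  rcases le_total ((σ j : ℝ) ^ 2) (ν / a j) with hc | hc
  · have hw : waterFill σ a ν j = (σ j : ℝ) ^ 2 := by
      rw [waterFill, if_neg haj, min_eq_left hc]
    rw [hw] at hpos ⊢
    refine mul_le_mul_of_nonpos_right ?_ (by linarith)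
    rw [← div_eq_inv_mul, ← inv_div]
    exact inv_anti₀ hpos hc
  · have hw : waterFill σ a ν j = ν / a j := by
      rw [waterFill, if_neg haj, min_eq_right hc]
    rw [hw, inv_div, div_eq_inv_mul]

lemma log_waterFill_sub_log (ha : ∀ j, 0 ≤ a j) (hfin : FiniteAllocation σ d)
    (hfin' : FiniteAllocation σ (waterFill σ a ν)) (j : Fin m) :
    Real.log ((σ j : ℝ) ^ 2 / waterFill σ a ν j) - Real.log ((σ j : ℝ) ^ 2 / d j) ≤
        ν⁻¹ * (a j * d j - a j * waterFill σ a ν j) ∧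
      (d j ≠ waterFill σ a ν j →
        Real.log ((σ j : ℝ) ^ 2 / waterFill σ a ν j) - Real.log ((σ j : ℝ) ^ 2 / d j) <
          ν⁻¹ * (a j * d j - a j * waterFill σ a ν j)) := by
  obtain ⟨h1, h2, h3⟩ := hfin j
  obtain ⟨h1', h2', h3'⟩ := hfin' j
  by_cases hσ : σ j = 0
  · have hd0 : d j = 0 := le_antisymm (by simpa [hσ] using h2) h1
    have hw0 : waterFill σ a ν j = 0 := le_antisymm (by simpa [hσ] using h2') h1'
    simp [hd0, hw0]
  have hdp : 0 < d j := lt_of_le_of_ne h1 fun h => hσ (h3 h.symm)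
  have hwp : 0 < waterFill σ a ν j := lt_of_le_of_ne h1' fun h => hσ (h3' h.symm)
  have hσp : (0 : ℝ) < (σ j : ℝ) ^ 2 := by positivity
  have key := sub_div_waterFill_le (d := d) ha j h2 hwp
  have e : Real.log ((σ j : ℝ) ^ 2 / waterFill σ a ν j) - Real.log ((σ j : ℝ) ^ 2 / d j) =
      Real.log (d j / waterFill σ a ν j) := by
    rw [Real.log_div hσp.ne' hwp.ne', Real.log_div hσp.ne' hdp.ne', Real.log_div hdp.ne' hwp.ne']
    ring
  rw [e]
  refine ⟨(Real.log_le_sub_one_of_pos (by positivity)).trans key, fun hne => ?_⟩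
  exact (Real.log_lt_sub_one_of_pos (by positivity)
    (fun h => hne (by rwa [div_eq_one_iff_eq hwp.ne'] at h))).trans_le key

lemma sum_log_waterFill_le (ha : ∀ j, 0 ≤ a j) (h : IsWaterLevel σ a ε ν)
    (hd : d ∈ queryAllocations σ a ε) (hfin : FiniteAllocation σ d) :
    ∑ j, Real.log ((σ j : ℝ) ^ 2 / waterFill σ a ν j) / 2 ≤
        ∑ j, Real.log ((σ j : ℝ) ^ 2 / d j) / 2 ∧
      (d ≠ waterFill σ a ν → ∑ j, Real.log ((σ j : ℝ) ^ 2 / waterFill σ a ν j) / 2 <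
        ∑ j, Real.log ((σ j : ℝ) ^ 2 / d j) / 2) := by
  have hfin' := finiteAllocation_waterFill ha h hd hfin
  have hc := log_waterFill_sub_log ha hfin hfin'
  -- Water-filling spends at least as much as any feasible allocation. At `ν = 0` the convention
  -- `0⁻¹ = 0` keeps the bound valid.
  have hs : ∑ j, ν⁻¹ * (a j * d j - a j * waterFill σ a ν j) ≤ 0 := by
    rw [← Finset.mul_sum, Finset.sum_sub_distrib]
    exact mul_nonpos_of_nonneg_of_nonpos (inv_nonneg.2 h.1)
      (sub_nonpos.2 (sum_mul_le_sum_mul_waterFill ha h hd))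
  simp_rw [← Finset.sum_div]
  constructor
  · have := Finset.sum_le_sum fun j (_ : j ∈ Finset.univ) => (hc j).1
    rw [Finset.sum_sub_distrib] at this
    linarith
  · intro hne
    obtain ⟨i, hi⟩ := Function.ne_iff.1 hne
    have := Finset.sum_lt_sum (fun j (_ : j ∈ Finset.univ) => (hc j).1)
      ⟨i, Finset.mem_univ i, (hc i).2 hi⟩
    rw [Finset.sum_sub_distrib] at this
    linarith

theorem isOptimalAllocation_waterFill (ha : ∀ j, 0 ≤ a j) (h : IsWaterLevel σ a ε ν) :
    IsOptimalAllocation σ a ε (waterFill σ a ν) := by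
  refine ⟨waterFill_mem ha h, fun d hd => ?_⟩
  by_cases ht : allocRate σ d = ∞
  · simp [ht]
  have hfin := finiteAllocation_of_allocRate_ne_top hd.1 ht
  change allocRate σ _ ≤ allocRate σ d
  rw [hfin.allocRate_eq, (finiteAllocation_waterFill ha h hd hfin).allocRate_eq]
  exact ENNReal.ofReal_le_ofReal (sum_log_waterFill_le ha h hd hfin).1

/-- Finiteness is needed: if the minimum is infinite, every feasible allocation is optimal. -/
theorem IsOptimalAllocation.eq_waterFill (ha : ∀ j, 0 ≤ a j) (h : IsWaterLevel σ a ε ν)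
    (hne : allocRate σ (waterFill σ a ν) ≠ ∞) (hd : IsOptimalAllocation σ a ε d) :
    d = waterFill σ a ν := by
  have hle : allocRate σ d ≤ allocRate σ (waterFill σ a ν) := hd.2 (waterFill_mem ha h)
  have hfin := finiteAllocation_of_allocRate_ne_top hd.1.1 (hle.trans_lt hne.lt_top).ne
  have hfin' := finiteAllocation_waterFill ha h hd.1 hfin
  by_contra hdne
  have hlt := (sum_log_waterFill_le ha h hd.1 hfin).2 hdne
  rw [hfin.allocRate_eq, hfin'.allocRate_eq] at hle
  refine hle.not_gt ((ENNReal.ofReal_lt_ofReal_iff_of_nonneg ?_).2 hlt)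
  exact Finset.sum_nonneg fun j _ => div_nonneg (hfin'.log_nonneg j) zero_le_two

end TaskCompression

namespace TaskCompression

/-! ### From joint laws to compressors and frontiers -/

lemma bayesRisk_self {Ω : Type*} [MeasurableSpace Ω] {P : Measure Ω} {m : ℕ}
    {S : Ω → Fin m → ℝ} (a : Fin m → ℝ) : bayesRisk P S S (quadLoss a) = 0 := by
  refine le_antisymm ((iInf₂_le id measurable_id).trans ?_) zero_le
  simp [quadLoss]

section Framework

variable {Ω : Type*} [MeasurableSpace Ω] {P : Measure Ω} [IsProbabilityMeasure P] {m : ℕ}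
  {S : Ω → Fin m → ℝ} {hS : Measurable S} {𝒵 : Type*} [MeasurableSpace 𝒵]
  {κ : Kernel (Fin m → ℝ) 𝒵} [IsMarkovKernel κ]

/-- Rate and risk depend on the compressor only through the joint law of source and representation;
this removes `Ω`. -/
lemma compressed_map_eq :
    (compressed P S hS κ).map (fun p => (S p.1, p.2)) = P.map S ⊗ₘ κ := by
  have : IsProbabilityMeasure (P.map S) := Measure.isProbabilityMeasure_map hS.aemeasurable
  have hm : Measurable fun p : Ω × 𝒵 => (S p.1, p.2) := by fun_prop
  ext t ht
  rw [Measure.map_apply hm ht, compressed, Measure.compProd_apply (hm ht),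
    Measure.compProd_apply ht, lintegral_map (Kernel.measurable_kernel_prodMk_left ht) hS]
  rfl

lemma compressedRate_eq :
    compressedRate P S hS κ =
      InformationTheory.klDiv (P.map S ⊗ₘ κ) ((P.map S ⊗ₘ κ).fst.prod (P.map S ⊗ₘ κ).snd) := by
  have hm : Measurable fun p : Ω × 𝒵 => (S p.1, p.2) := by fun_prop
  rw [compressedRate, mutualInfo, ← compressed_map_eq (hS := hS), Measure.fst, Measure.snd,
    Measure.map_map measurable_fst hm, Measure.map_map measurable_snd hm]
  rfl

lemma lintegral_compressed_quadLoss (a : Fin m → ℝ) {φ : 𝒵 → Fin m → ℝ} (hφ : Measurable φ) :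
    ∫⁻ p, ENNReal.ofReal (quadLoss a (φ p.2) (S p.1)) ∂compressed P S hS κ =
      ∫⁻ x, ENNReal.ofReal (quadLoss a (φ x.2) x.1) ∂(P.map S ⊗ₘ κ) := by
  have hq : Measurable fun x : (Fin m → ℝ) × 𝒵 => ENNReal.ofReal (quadLoss a (φ x.2) x.1) := by
    unfold quadLoss; fun_prop
  rw [← compressed_map_eq (hS := hS), lintegral_map hq (by fun_prop)]

lemma compressedRisk_le (a : Fin m → ℝ) {φ : 𝒵 → Fin m → ℝ} (hφ : Measurable φ) :
    compressedRisk P S hS κ S (quadLoss a) ≤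
      ∫⁻ x, ENNReal.ofReal (quadLoss a (φ x.2) x.1) ∂(P.map S ⊗ₘ κ) := by
  rw [← lintegral_compressed_quadLoss (hS := hS) a hφ]
  exact iInf₂_le φ hφ

lemma le_compressedRisk {a : Fin m → ℝ} {c : ℝ≥0∞} (h : ∀ φ : 𝒵 → Fin m → ℝ, Measurable φ →
    c ≤ ∫⁻ x, ENNReal.ofReal (quadLoss a (φ x.2) x.1) ∂(P.map S ⊗ₘ κ)) :
    c ≤ compressedRisk P S hS κ S (quadLoss a) := by
  refine le_iInf₂ fun φ hφ => ?_
  rw [lintegral_compressed_quadLoss (hS := hS) a hφ]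
  exact h φ hφ

variable {σ : Fin m → ℝ≥0}

/-- Converse in terms of the Bayes risk of a compressor. -/
lemma exists_allocation_le_compressedRate (hlaw : P.map S = gaussianSource σ) :
    ∃ d : Fin m → ℝ, (∀ j, 0 ≤ d j ∧ d j ≤ (σ j : ℝ) ^ 2) ∧
      (∀ a : Fin m → ℝ, (∀ j, 0 ≤ a j) →
        ENNReal.ofReal (∑ j, a j * d j) ≤ compressedRisk P S hS κ S (quadLoss a)) ∧
      allocRate σ d ≤ compressedRate P S hS κ := by
  obtain ⟨d, h1, h2, h3⟩ := exists_allocation_le_klDiv (J := gaussianSource σ ⊗ₘ κ) (σ := σ)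
    (by simp)
  rw [← hlaw] at h2 h3
  exact ⟨d, h1, fun a ha => le_compressedRisk fun φ hφ => h2 a ha φ hφ,
    h3.trans_eq (compressedRate_eq (hS := hS)).symm⟩

/-- The Gaussian test channel achieves the rate of its allocation. -/
lemma IsTestChannel.compressedRate_eq {κ : Kernel (Fin m → ℝ) (Fin m → ℝ)} [IsMarkovKernel κ]
    {d : Fin m → ℝ} (hκ : IsTestChannel σ d κ) (hd : FiniteAllocation σ d)
    (hlaw : P.map S = gaussianSource σ) :
    compressedRate P S hS κ = allocRate σ d := by
  rw [TaskCompression.compressedRate_eq, hlaw, Measure.fst_compProd, hκ.klDiv_eq hd,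
    hd.allocRate_eq]

/-- The Gaussian test channel achieves the distortion of its allocation. -/
lemma IsTestChannel.compressedRisk_le {κ : Kernel (Fin m → ℝ) (Fin m → ℝ)} [IsMarkovKernel κ]
    {d : Fin m → ℝ} (hκ : IsTestChannel σ d κ) (hd : FiniteAllocation σ d)
    (hlaw : P.map S = gaussianSource σ) {a : Fin m → ℝ} (ha : ∀ j, 0 ≤ a j) :
    compressedRisk P S hS κ S (quadLoss a) ≤ ENNReal.ofReal (∑ j, a j * d j) := by
  have hm : Measurable (reconstruct σ d) := by fun_prop
  refine (TaskCompression.compressedRisk_le a hm).trans_eq ?_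
  rw [hlaw, lintegral_quadLoss ha hm,
    ENNReal.ofReal_sum_of_nonneg fun j _ => mul_nonneg (ha j) (hd j).1]
  exact Finset.sum_congr rfl fun j _ => by rw [hκ.lintegral_sq hd, ENNReal.ofReal_mul (ha j)]

lemma compressedRisk_eq_zero_of_dirac {κ : Kernel (Fin m → ℝ) (Fin m → ℝ)} [IsMarkovKernel κ]
    (hκ : ∀ s, κ s = Measure.dirac s) (a : Fin m → ℝ) :
    compressedRisk P S hS κ S (quadLoss a) = 0 := by
  have : IsProbabilityMeasure (P.map S) := Measure.isProbabilityMeasure_map hS.aemeasurable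
  refine le_antisymm ((compressedRisk_le a measurable_id).trans_eq ?_) zero_le
  rw [Measure.lintegral_compProd (by unfold quadLoss; fun_prop)]
  simp [hκ, quadLoss]

end Framework

section TestChannel

variable {𝒬 : Type*} [MeasurableSpace 𝒬] {m : ℕ}

/-- Gaussian test channels with a query-dependent allocation. -/
noncomputable def testChannel (σ : Fin m → ℝ≥0) (D : 𝒬 → Fin m → ℝ) :
    Kernel ((Fin m → ℝ) × 𝒬) (Fin m → ℝ) :=
  (Kernel.const _ (gaussianSource fun _ => 1)).withDensity fun x w =>
    ENNReal.ofReal (Real.exp (logAllocRatio σ (D x.2) (reconstruct σ (D x.2) w) x.1))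

variable {σ : Fin m → ℝ≥0} {D : 𝒬 → Fin m → ℝ}

lemma testChannel_apply (hD : Measurable D) (x : (Fin m → ℝ) × 𝒬) :
    testChannel σ D x = (gaussianSource fun _ => 1).withDensity fun w =>
      ENNReal.ofReal (Real.exp (logAllocRatio σ (D x.2) (reconstruct σ (D x.2) w) x.1)) := by
  rw [testChannel, Kernel.withDensity_apply, Kernel.const_apply]
  unfold Function.uncurry
  fun_prop

lemma isMarkovKernel_testChannel (hD : Measurable D) (hfin : ∀ q, FiniteAllocation σ (D q)) :
    IsMarkovKernel (testChannel σ D) := by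
  refine ⟨fun x => ⟨?_⟩⟩
  rw [testChannel_apply hD, withDensity_apply _ .univ, Measure.restrict_univ]
  exact lintegral_exp_logAllocRatio_reconstruct (hfin x.2) x.1

lemma isTestChannel_sectL_testChannel (hD : Measurable D) (q : 𝒬) :
    IsTestChannel σ (D q) ((testChannel σ D).sectL q) := fun s => by
  rw [Kernel.sectL_apply, testChannel_apply hD]

/-- A measurable family of allocations is realized by one query-conditioned compressor: Gaussian
test channels where the rate is finite, and lossless transmission elsewhere. -/
lemma exists_kernel_of_allocations (hD : Measurable D)
    (hbox : ∀ q j, 0 ≤ D q j ∧ D q j ≤ (σ j : ℝ) ^ 2) :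
    ∃ κ : Kernel ((Fin m → ℝ) × 𝒬) (Fin m → ℝ), IsMarkovKernel κ ∧
      (∀ q, allocRate σ (D q) ≠ ∞ → IsTestChannel σ (D q) (κ.sectL q)) ∧
      ∀ q, allocRate σ (D q) = ∞ → ∀ s, κ.sectL q s = Measure.dirac s := by
  classical
  have hG : MeasurableSet {q | allocRate σ (D q) ≠ ∞} :=
    ((continuous_allocRate σ).measurable.comp hD) (measurableSet_singleton ∞).compl
  -- The filler `σ ^ 2` is a finite allocation, so the test channel is Markov at every query.
  -- Queries of infinite rate are then overridden by the identity, as the risk constraint binds at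
  -- all queries and not merely almost all.
  set D' : 𝒬 → Fin m → ℝ := fun q => if allocRate σ (D q) ≠ ∞ then D q else fun j => (σ j : ℝ) ^ 2
    with hD'
  have hD'm : Measurable D' := Measurable.ite hG hD measurable_const
  have hfin : ∀ q, FiniteAllocation σ (D' q) := by
    intro q
    by_cases h : allocRate σ (D q) ≠ ∞
    · simpa only [hD', if_pos h] using finiteAllocation_of_allocRate_ne_top (hbox q) h
    · simp only [hD', if_neg h]
      exact fun j => ⟨sq_nonneg _, le_rfl, fun h0 => by simpa using h0⟩
  have := isMarkovKernel_testChannel hD'm hfin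
  have hG' : MeasurableSet {x : (Fin m → ℝ) × 𝒬 | allocRate σ (D x.2) ≠ ∞} := measurable_snd hG
  refine ⟨Kernel.piecewise hG' (testChannel σ D') (Kernel.deterministic Prod.fst measurable_fst),
    inferInstance, fun q hq => ?_, fun q hq s => ?_⟩
  · intro s
    have := isTestChannel_sectL_testChannel (σ := σ) hD'm q s
    rw [Kernel.sectL_apply] at this ⊢
    rw [Kernel.piecewise_apply, if_pos (by exact hq), this]
    simp only [hD', if_pos hq]
  · rw [Kernel.sectL_apply, Kernel.piecewise_apply, if_neg (by simp [hq]),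
      Kernel.deterministic_apply]

end TestChannel

section Frontier

variable {Ω 𝒬 : Type*} [MeasurableSpace Ω] {P : Measure Ω}
  [IsProbabilityMeasure P] {m : ℕ} {S : Ω → Fin m → ℝ} {hS : Measurable S} {σ : Fin m → ℝ≥0}
  {α : 𝒬 → Fin m → ℝ} {ε : ℝ}

theorem isLeast_bayesFrontier (hlaw : P.map S = gaussianSource σ) (hα : ∀ q j, 0 ≤ α q j)
    (hε : 0 ≤ ε) :
    IsLeast (allocRate σ '' familyAllocations σ α ε)
      (bayesFrontier P S hS (fun _ : 𝒬 => S) (fun q => quadLoss (α q)) ε) := by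
  obtain ⟨d, hd, hmin⟩ := exists_isLeast_familyAllocations σ α hε
  suffices h : bayesFrontier P S hS (fun _ : 𝒬 => S) (fun q => quadLoss (α q)) ε =
      allocRate σ d by
    rw [h]
    exact ⟨⟨d, hd, rfl⟩, by rintro _ ⟨d', hd', rfl⟩; exact hmin hd'⟩
  refine le_antisymm ?_ ?_
  · by_cases ht : allocRate σ d = ∞
    · simp [ht]
    have hfin := finiteAllocation_of_allocRate_ne_top hd.1 ht
    obtain ⟨κ, hκ, hκ1, -⟩ := exists_kernel_of_allocations (𝒬 := Unit) (σ := σ) (D := fun _ => d)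
      measurable_const (fun _ => hd.1)
    have hch := hκ1 () ht
    rw [← hch.compressedRate_eq (hS := hS) hfin hlaw]
    refine iInf_le_of_le (Fin m → ℝ) (iInf_le_of_le inferInstance (iInf_le_of_le inferInstance
      (iInf_le_of_le (κ.sectL ()) (iInf_le_of_le inferInstance (iInf_le_of_le ?_ le_rfl)))))
    refine iSup_le fun q => tsub_le_self.trans ?_
    exact (hch.compressedRisk_le hfin hlaw (hα q)).trans (ENNReal.ofReal_le_ofReal (hd.2 q))
  · refine le_iInf fun 𝒵 => le_iInf fun _ => le_iInf fun _ => le_iInf fun κ => le_iInf fun _ =>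
      le_iInf fun hκ => ?_
    obtain ⟨d', h1, h2, h3⟩ := exists_allocation_le_compressedRate (hS := hS) (κ := κ) hlaw
    refine le_trans (hmin ⟨h1, fun q => ?_⟩) h3
    rw [← ENNReal.ofReal_le_ofReal_iff hε]
    refine (h2 _ (hα q)).trans (le_trans ?_ hκ)
    refine le_trans ?_ (le_iSup _ q)
    -- The uncompressed risk is 0, so the excess constraint bounds the risk itself.
    rw [bayesRisk_self, tsub_zero]

/-- Both the constraint and the rate decouple over queries: the converse holds separately at each
`q`, and a single measurable kernel attains all the pointwise minima. -/
theorem bayesFrontierCond_eq [MeasurableSpace 𝒬] (μ : Measure 𝒬) (hlaw : P.map S = gaussianSource σ)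
    (hα : ∀ q j, 0 ≤ α q j) (hαm : Measurable α) (hε : 0 ≤ ε) :
    bayesFrontierCond P S hS μ (fun _ : 𝒬 => S) (fun q => quadLoss (α q)) ε =
      ∫⁻ q, allocRate σ (waterFill σ (α q) (waterLevel σ (α q) ε)) ∂μ := by
  have hopt := fun q => isOptimalAllocation_waterFill (hα q)
    (isWaterLevel_waterLevel σ (hα q) hε)
  refine le_antisymm ?_ ?_
  · obtain ⟨κ, hκ, hκ1, hκ2⟩ := exists_kernel_of_allocations
      (measurable_waterFill_waterLevel σ hα hαm hε) (fun q => (hopt q).1.1)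
    refine iInf_le_of_le (Fin m → ℝ) (iInf_le_of_le inferInstance (iInf_le_of_le inferInstance
      (iInf_le_of_le κ (iInf_le_of_le hκ (iInf_le_of_le ?_ ?_)))))
    · refine iSup_le fun q => tsub_le_self.trans ?_
      by_cases ht : allocRate σ (waterFill σ (α q) (waterLevel σ (α q) ε)) = ∞
      · rw [compressedRisk_eq_zero_of_dirac (hκ2 q ht)]
        exact zero_le
      · exact ((hκ1 q ht).compressedRisk_le (finiteAllocation_of_allocRate_ne_top (hopt q).1.1 ht)
          hlaw (hα q)).trans (ENNReal.ofReal_le_ofReal (hopt q).1.2)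
    · refine lintegral_mono fun q => ?_
      by_cases ht : allocRate σ (waterFill σ (α q) (waterLevel σ (α q) ε)) = ∞
      · simp [ht]
      · exact ((hκ1 q ht).compressedRate_eq
          (finiteAllocation_of_allocRate_ne_top (hopt q).1.1 ht) hlaw).le
  · refine le_iInf fun 𝒵 => le_iInf fun _ => le_iInf fun _ => le_iInf fun κ => le_iInf fun _ =>
      le_iInf fun hκ => lintegral_mono fun q => ?_
    obtain ⟨d', h1, h2, h3⟩ := exists_allocation_le_compressedRate (hS := hS) (κ := κ.sectL q) hlaw
    refine le_trans ((hopt q).2 ⟨h1, ?_⟩) h3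
    rw [← ENNReal.ofReal_le_ofReal_iff hε]
    refine (h2 _ (hα q)).trans (le_trans ?_ hκ)
    refine le_trans ?_ (le_iSup _ q)
    rw [bayesRisk_self, tsub_zero]

end Frontier

end TaskCompression

theorem mainTheorem5
    {Ω 𝒬 : Type*} [MeasurableSpace Ω] [MeasurableSpace 𝒬]
    (P : Measure Ω) [IsProbabilityMeasure P]
    (μ : Measure 𝒬) [IsProbabilityMeasure μ]
    (m : ℕ) (σ : Fin m → ℝ≥0)
    (S : Ω → Fin m → ℝ) (hS : Measurable S)
    (hlaw : ∀ j, P.map (fun ω => S ω j) = gaussianReal 0 (σ j ^ 2))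
    (hindep : iIndepFun (fun j ω => S ω j) P)
    (α : 𝒬 → Fin m → ℝ) (hα : ∀ q j, 0 ≤ α q j) (hαm : Measurable α)
    (ε : ℝ) (hε : 0 ≤ ε) :
    -- the raw observation `X = S` has zero Bayes risk for every query
    (∀ q, TaskCompression.bayesRisk P S S (TaskCompression.quadLoss (α q)) = 0) ∧
    -- the query-agnostic frontier is the minimal rate of an allocation feasible for all queries
    IsLeast
      (TaskCompression.allocRate σ '' TaskCompression.familyAllocations σ α ε)
      (TaskCompression.bayesFrontier P S hS (fun _ : 𝒬 => S)
        (fun q => TaskCompression.quadLoss (α q)) ε) ∧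
    -- the query-conditioned frontier is the average over `Q ∼ μ` of the per-query minima
    (∃ r : 𝒬 → ℝ≥0∞, Measurable r ∧
      (∀ q, IsLeast
        (TaskCompression.allocRate σ '' TaskCompression.queryAllocations σ (α q) ε) (r q)) ∧
      TaskCompression.bayesFrontierCond P S hS μ (fun _ : 𝒬 => S)
        (fun q => TaskCompression.quadLoss (α q)) ε = ∫⁻ q, r q ∂μ) ∧
    -- the per-query optimizer is weighted reverse water-filling
    (∀ q,
      (∃ ν, TaskCompression.IsWaterLevel σ (α q) ε ν) ∧
      ∀ ν, TaskCompression.IsWaterLevel σ (α q) ε ν →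
        TaskCompression.IsOptimalAllocation σ (α q) ε
          (TaskCompression.waterFill σ (α q) ν) ∧
        (TaskCompression.allocRate σ (TaskCompression.waterFill σ (α q) ν) ≠ ∞ →
          ∀ d, TaskCompression.IsOptimalAllocation σ (α q) ε d →
            d = TaskCompression.waterFill σ (α q) ν)) := by
  have hlawS : P.map S = TaskCompression.gaussianSource σ := by
    rw [TaskCompression.gaussianSource, ← funext hlaw]
    exact (iIndepFun_iff_map_fun_eq_pi_map fun j => by fun_prop).1 hindep
  have hopt := fun q => TaskCompression.isOptimalAllocation_waterFill (hα q)
    (TaskCompression.isWaterLevel_waterLevel σ (hα q) hε)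
  refine ⟨fun q => TaskCompression.bayesRisk_self _,
    TaskCompression.isLeast_bayesFrontier hlawS hα hε, ⟨_, ?_, fun q => ?_,
      TaskCompression.bayesFrontierCond_eq μ hlawS hα hαm hε⟩, fun q =>
    ⟨⟨_, TaskCompression.isWaterLevel_waterLevel σ (hα q) hε⟩, fun ν hν =>
      ⟨TaskCompression.isOptimalAllocation_waterFill (hα q) hν, fun hne d hd =>
        TaskCompression.IsOptimalAllocation.eq_waterFill (hα q) hν hne hd⟩⟩⟩
  · exact (TaskCompression.continuous_allocRate σ).measurable.comp
      (TaskCompression.measurable_waterFill_waterLevel σ hα hαm hε)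
  · exact ⟨⟨_, (hopt q).1, rfl⟩, by rintro _ ⟨d, hd, rfl⟩; exact (hopt q).2 hd⟩
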